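/- **Theorem (label bound).** There is an absolute constant $N_0$ such that the following holds. Let $D\in\mathbb{Q}[t]$ be a non-constant polynomial for which Pell's equation $X^2-D\,Y^2=1$ has a solution $(X,Y)\in\mathbb{Q}[t]^2$ with $Y\neq 0$, and let $(u,v)\in\mathbb{Q}[t]^2$ be a fundamental solution, i.e. a solution with $v\neq 0$ of smallest possible degree. For $n\ge 1$ define $u_n,v_n\in\mathbb{Q}[t]$ by $u_n+v_n\sqrt D=(u+v\sqrt D)^n$, and write $v_n=v_n^{\mathrm{old}}\,v_n^{\mathrm{new}}$, where $v_n^{\mathrm{old}}$ is the product (with multiplicity) of the monic irreducible factors of $v_n$ that also divide $v_m$ for some $1\le m<n$, and $v_n^{\mathrm{new}}$ is the product of the remaining irreducible factors of $v_n$, with multiplicity, times the leading coefficient of $v_n$. For a positive integer $N$ let $I(N)$ be the set of irreducible polynomials $P\in\mathbb{Q}[t]$, taken up to multiplication by nonzero constants (i.e. monic), with $\deg P\le N$ and $P\mid v_n^{\mathrm{new}}$ for some $n\ge 1$. Then, for every $N\ge N_0$, the set $I(N)$ is finite and $$\#I(N)\le 10\,N\deg u .$$ -/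

import Mathlib

open Polynomial

noncomputable section

/-- `(u, v)` is a fundamental solution of Pell's equation `X ^ 2 - D * Y ^ 2 = 1` in `K[t]`:
a solution with `v ≠ 0` whose second component has the smallest possible degree. -/
structure IsFundamentalSolution {K : Type*} [Field K] (D u v : K[X]) : Prop where
  pell : u ^ 2 - D * v ^ 2 = 1
  ne_zero : v ≠ 0
  degree_le : ∀ x y : K[X], x ^ 2 - D * y ^ 2 = 1 → y ≠ 0 → v.degree ≤ y.degree

/-- The polynomial `v_n`, given by `u_n + v_n √D = (u + v √D) ^ n`. The power is taken in
`K[t][ω] / (ω ^ 2 - D)`, where the class of `ω` is `√D`. -/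
def pellV {K : Type*} [Field K] (D u v : K[X]) (n : ℕ) : K[X] :=
  ((⟨u, v⟩ : QuadraticAlgebra K[X] D 0) ^ n).im

/-- A factor `P` of `v_n` is old if it also divides `v_m` for some positive `m < n`. -/
def IsOldFactor {K : Type*} [Field K] (D u v : K[X]) (n : ℕ) (P : K[X]) : Prop :=
  ∃ m : ℕ, 0 < m ∧ m < n ∧ P ∣ pellV D u v m

open Classical in
/-- `v_n^old`: the product, with multiplicity, of the (monic) irreducible factors of `v_n`
that also divide `v_m` for some positive `m < n`. -/
def pellVOld {K : Type*} [Field K] (D u v : K[X]) (n : ℕ) : K[X] :=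
  ((UniqueFactorizationMonoid.normalizedFactors (pellV D u v n)).filter
    (fun P => IsOldFactor D u v n P)).prod

open Classical in
/-- `v_n^new`: the product, with multiplicity, of the remaining irreducible factors of `v_n`,
times the leading coefficient of `v_n`. -/
def pellVNew {K : Type*} [Field K] (D u v : K[X]) (n : ℕ) : K[X] :=
  C (pellV D u v n).leadingCoeff *
    ((UniqueFactorizationMonoid.normalizedFactors (pellV D u v n)).filter
      (fun P => ¬ IsOldFactor D u v n P)).prod

/-- The factorisation `v_n = v_n^old * v_n^new`. -/
theorem pellVOld_mul_pellVNew {K : Type*} [Field K] (D u v : K[X]) (n : ℕ) :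
    pellVOld D u v n * pellVNew D u v n = pellV D u v n := by
  classical
  by_cases h0 : pellV D u v n = 0
  · simp [pellVNew, h0]
  · unfold pellVOld pellVNew
    rw [mul_left_comm, ← Multiset.prod_add, Multiset.filter_add_not,
      UniqueFactorizationMonoid.prod_normalizedFactors_eq h0, normalize_apply,
      Polynomial.coe_normUnit_of_ne_zero h0, mul_left_comm, ← C_mul,
      mul_inv_cancel₀ (leadingCoeff_ne_zero.mpr h0), C_1, mul_one]

/-- `I(N)`: the irreducible polynomials over `ℚ` of degree at most `N` that divide `v_n^new` for
some `n ≥ 1`, counted up to a nonzero constant factor, that is, represented by the monic ones. -/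
def newFactors (D u v : ℚ[X]) (N : ℕ) : Set ℚ[X] :=
  {P | P.Monic ∧ Irreducible P ∧ P.natDegree ≤ N ∧ ∃ n : ℕ, 1 ≤ n ∧ P ∣ pellVNew D u v n}

end

/-! Let `x` be a root of an irreducible `P` dividing `v_n`. At `x` the numbers `(u ± v√D)^n`
coincide, and `u ± v√D` are mutually inverse, so `ξ = u(x) + v(x)√D(x)` is a root of unity with `ξ +
ξ⁻¹ = 2u(x)` (`exists_root_of_unity`). If `ξ` has order `k`, then `ξ` is at most quadratic over
`ℚ(x)`, whence `φ(k) ≤ 2 deg P ≤ 2N`. Galois conjugation lets one fixed primitive `k`-th root `ζ`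
replace `ξ` (`exists_root_of_irreducible`), so `P` is the minimal polynomial of one of the at most
`deg u` solutions of `2u(x) = ζ + ζ⁻¹`.

It remains to see that at most `5y` integers `k` have `φ(k) ≤ y` (`card_totient_le`), used with `y =
2N`. Up to `4y` all integers are counted; beyond, a fourth-moment bound on `1/φ(k)` leaves at most
`y`. Only `v_n^new ∣ v_n` is needed about new factors. -/

namespace PellNewFactors

/-! ### Integers with small totient -/

/-- The excess of `(p / (p - 1)) ^ 4` over `1`. -/
def excess (p : ℕ) : ℚ := ((p : ℚ) / (p - 1)) ^ 4 - 1

theorem excess_nonneg {p : ℕ} (hp : 2 ≤ p) : 0 ≤ excess p := by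
  have h : (2 : ℚ) ≤ p := by exact_mod_cast hp
  have : (1 : ℚ) ≤ (p : ℚ) / (p - 1) := by
    rw [le_div_iff₀] <;> linarith
  exact sub_nonneg.2 (one_le_pow₀ this)

/-- The right side is `f(n+2)/f(n)` for `f(n) = (n-2)/(n+2)`, so the product over odd `n`
telescopes. -/
theorem one_add_excess_div_le {n : ℚ} (hn : 5 ≤ n) :
    1 + ((n / (n - 1)) ^ 4 - 1) / n ≤ n * (n + 2) / ((n + 4) * (n - 2)) := by
  obtain ⟨m, rfl⟩ : ∃ m, n = m + 1 := ⟨n - 1, by ring⟩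
  have hm : 4 ≤ m := by linarith
  have h1 : 0 < m + 1 + 4 := by linarith
  have h2 : 0 < m + 1 - 2 := by linarith
  have h0 : 0 < m := by linarith
  have h3 : 0 < m + 1 := by linarith
  have e : 1 + (((m + 1) / (m + 1 - 1)) ^ 4 - 1) / (m + 1)
      = (m ^ 4 * (m + 1) + (4 * m ^ 3 + 6 * m ^ 2 + 4 * m + 1)) / (m ^ 4 * (m + 1)) := by
    rw [add_sub_cancel_right]
    field_simp
    ring
  rw [e, div_le_div_iff₀ (by positivity) (by positivity)]
  -- After cross-multiplication the difference of the two sides is twice this term plus the one in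
  -- `h5`.
  have h4 : 0 ≤ m ^ 3 * ((2 * m + 1) * (m - 4)) :=
    mul_nonneg (by positivity) (mul_nonneg (by linarith) (by linarith))
  have h5 : 0 ≤ 13 * m ^ 2 + 16 * m + 5 := by positivity
  nlinarith [h4, h5]

theorem prod_odd_le (J : ℕ) :
    ∏ j ∈ Finset.range J, (1 + excess (2 * j + 5) / (2 * j + 5 : ℕ))
      ≤ 7 / 3 * ((2 * J + 3) / (2 * J + 7)) := by
  induction J with
  | zero => norm_num
  | succ J ih =>
    rw [Finset.prod_range_succ]
    have hJ : (0 : ℚ) ≤ J := J.cast_nonneg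
    have h := one_add_excess_div_le (n := ((2 * J + 5 : ℕ) : ℚ)) (by push_cast; linarith)
    have h0 : 0 ≤ 1 + excess (2 * J + 5) / (2 * J + 5 : ℕ) :=
      add_nonneg zero_le_one (div_nonneg (excess_nonneg (by omega)) (Nat.cast_nonneg _))
    calc _ ≤ (7 / 3 * ((2 * J + 3) / (2 * J + 7)) : ℚ) * _ :=
          mul_le_mul ih h h0 (by positivity)
      _ = _ := by
        push_cast
        have : (2 * (J : ℚ) + 5 - 2) = 2 * J + 3 := by ring
        rw [this]
        field_simp
        ring

/-- The primes 2 and 3 are treated exactly; the others are enlarged to all odd numbers from 5 on,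
where the telescoped product stays below 7/3. -/
theorem prod_primes_le (L : ℕ) :
    ∏ p ∈ (Finset.Icc 1 L).filter Nat.Prime, (1 + excess p / p) ≤ 48 := by
  let T : Finset ℕ := {2, 3} ∪ (Finset.range L).image (fun j => 2 * j + 5)
  have hsub : (Finset.Icc 1 L).filter Nat.Prime ⊆ T := by
    intro p hp
    simp only [Finset.mem_filter, Finset.mem_Icc] at hp
    obtain ⟨⟨-, hL⟩, hp⟩ := hp
    simp only [T, Finset.mem_union, Finset.mem_insert, Finset.mem_singleton, Finset.mem_image,
      Finset.mem_range]
    by_cases h2 : p = 2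
    · simp [h2]
    by_cases h3 : p = 3
    · simp [h3]
    have h1 := hp.two_le
    have := hp.eq_two_or_odd
    exact Or.inr ⟨(p - 5) / 2, by omega, by omega⟩
  have hT : ∀ p ∈ T, 2 ≤ p := by
    intro p hp
    simp only [T, Finset.mem_union, Finset.mem_insert, Finset.mem_singleton, Finset.mem_image,
      Finset.mem_range] at hp
    omega
  have hone : ∀ p ∈ T, 1 ≤ 1 + excess p / p := fun p hp =>
    le_add_of_nonneg_right (div_nonneg (excess_nonneg (hT p hp)) (Nat.cast_nonneg _))
  calc _ ≤ ∏ p ∈ T, (1 + excess p / p) := by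
        rw [← Finset.prod_sdiff hsub]
        exact le_mul_of_one_le_left
          (Finset.prod_nonneg fun p hp => zero_le_one.trans (hone p (hsub hp)))
          (Finset.one_le_prod fun p hp => hone p (Finset.mem_sdiff.1 hp).1)
    _ = (∏ p ∈ ({2, 3} : Finset ℕ), (1 + excess p / p)) *
          ∏ j ∈ Finset.range L, (1 + excess (2 * j + 5) / (2 * j + 5 : ℕ)) := by
        rw [Finset.prod_union, Finset.prod_image]
        · intro a _ b _ h
          simpa using h
        · rw [Finset.disjoint_left]
          intro p hp hp'
          simp only [Finset.mem_insert, Finset.mem_singleton, Finset.mem_image] at hp hp'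
          omega
    _ ≤ 1921 / 96 * (7 / 3) := by
        have h1 : ∏ p ∈ ({2, 3} : Finset ℕ), (1 + excess p / p) = 1921 / 96 := by
          rw [Finset.prod_pair (by norm_num)]
          norm_num [excess]
        rw [h1]
        refine mul_le_mul_of_nonneg_left ((prod_odd_le L).trans ?_) (by norm_num)
        have hL : (0 : ℚ) ≤ L := L.cast_nonneg
        have : (2 * (L : ℚ) + 3) / (2 * L + 7) ≤ 1 := by
          rw [div_le_one] <;> linarith
        linarith
    _ ≤ 48 := by norm_num

/-- Telescoping against `4/(3m³)`: the integral would suggest `1/(3m³)`, and the factor 4 makes each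
step valid already from `m = 1`. -/
theorem sum_inv_pow_four_le {M : ℕ} (hM : 1 ≤ M) (L : ℕ) :
    ∑ m ∈ Finset.Ico M L, ((m : ℚ) ^ 4)⁻¹ ≤ 4 / 3 / (M : ℚ) ^ 3 := by
  suffices h : ∀ j : ℕ, ∑ m ∈ Finset.Ico M (M + j), ((m : ℚ) ^ 4)⁻¹
      ≤ 4 / 3 / (M : ℚ) ^ 3 - 4 / 3 / ((M + j : ℕ) : ℚ) ^ 3 by
    rcases le_total M L with hL | hL
    · obtain ⟨j, rfl⟩ := Nat.exists_eq_add_of_le hL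
      exact (h j).trans (sub_le_self _ (by positivity))
    · rw [Finset.Ico_eq_empty_of_le hL]
      simp only [Finset.sum_empty]
      positivity
  intro j
  induction j with
  | zero => simp
  | succ j ih =>
    rw [← add_assoc, Finset.sum_Ico_succ_top (by omega)]
    have hm : (1 : ℚ) ≤ ((M + j : ℕ) : ℚ) := by exact_mod_cast (by omega : 1 ≤ M + j)
    rw [Nat.cast_add_one (M + j)]
    set m : ℚ := ((M + j : ℕ) : ℚ)
    have : (m ^ 4)⁻¹ ≤ 4 / 3 / m ^ 3 - 4 / 3 / (m + 1) ^ 3 := by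
      have e : 4 / 3 / m ^ 3 - 4 / 3 / (m + 1) ^ 3
          = 4 * m * (3 * m ^ 2 + 3 * m + 1) / (3 * m ^ 4 * (m + 1) ^ 3) := by
        field_simp
        ring
      rw [e, inv_eq_one_div, div_le_div_iff₀ (by positivity) (by positivity)]
      have : 0 ≤ m ^ 4 * (m - 1) := mul_nonneg (by positivity) (by linarith)
      have h2 : 3 * (m + 1) ^ 3 ≤ 4 * m * (3 * m ^ 2 + 3 * m + 1) := by
        nlinarith [mul_nonneg (by linarith : 0 ≤ m) (by linarith : 0 ≤ m - 1),
          mul_nonneg (sq_nonneg m) (by linarith : 0 ≤ m - 1)]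
      nlinarith [mul_le_mul_of_nonneg_left h2 (by positivity : 0 ≤ m ^ 4)]
    linarith

theorem sum_multiples_inv_pow_four_le {d y : ℕ} (hd : 1 ≤ d) (hy : 1 ≤ y) (L : ℕ) :
    ∑ k ∈ (Finset.Ioc y L).filter (d ∣ ·), ((k : ℚ) ^ 4)⁻¹ ≤ 4 / 3 / (d * (y : ℚ) ^ 3) := by
  -- The least `M` with `d * M > y`.
  set M := y / d + 1
  have hMd : y < d * M := by
    have := Nat.lt_mul_div_succ y (by omega : 0 < d)
    simpa [M] using this
  have hdq : (1 : ℚ) ≤ d := by exact_mod_cast hd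
  have hyq : (1 : ℚ) ≤ y := by exact_mod_cast hy
  have hMq : (1 : ℚ) ≤ M := by exact_mod_cast Nat.le_add_left 1 (y / d)
  have hsub : (Finset.Ioc y L).filter (d ∣ ·) ⊆ (Finset.Ico M (L + 1)).image (d * ·) := by
    intro k hk
    simp only [Finset.mem_filter, Finset.mem_Ioc] at hk
    obtain ⟨⟨h1, h2⟩, m, rfl⟩ := hk
    refine Finset.mem_image.2 ⟨m, Finset.mem_Ico.2 ⟨?_, ?_⟩, rfl⟩
    · exact Nat.div_lt_of_lt_mul h1
    · have := Nat.le_mul_of_pos_left m (by omega : 0 < d)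
      omega
  calc _ ≤ ∑ k ∈ (Finset.Ico M (L + 1)).image (d * ·), ((k : ℚ) ^ 4)⁻¹ :=
        Finset.sum_le_sum_of_subset_of_nonneg hsub (fun _ _ _ => by positivity)
    _ = ((d : ℚ) ^ 4)⁻¹ * ∑ m ∈ Finset.Ico M (L + 1), ((m : ℚ) ^ 4)⁻¹ := by
        rw [Finset.sum_image (fun a _ b _ h => Nat.eq_of_mul_eq_mul_left (by omega) h),
          Finset.mul_sum]
        refine Finset.sum_congr rfl fun m _ => ?_
        push_cast
        rw [mul_pow, mul_inv]
    _ ≤ ((d : ℚ) ^ 4)⁻¹ * (4 / 3 / (M : ℚ) ^ 3) :=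
        mul_le_mul_of_nonneg_left (sum_inv_pow_four_le (Nat.le_add_left 1 _) _) (by positivity)
    _ = 4 / 3 / (d * ((d * M : ℕ) : ℚ) ^ 3) := by
        push_cast
        field_simp
    _ ≤ _ := by
        gcongr

theorem div_totient_pow_four {k : ℕ} (hk : k ≠ 0) :
    ((k : ℚ) / k.totient) ^ 4 = ∏ p ∈ k.primeFactors, (1 + excess p) := by
  have hk' : (k : ℚ) ≠ 0 := by exact_mod_cast hk
  have : (k : ℚ) / k.totient = ∏ p ∈ k.primeFactors, ((p : ℚ) / (p - 1)) := by
    rw [Nat.totient_eq_mul_prod_factors, div_mul_eq_div_div, div_self hk', one_div,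
      ← Finset.prod_inv_distrib]
    refine Finset.prod_congr rfl fun p hp => ?_
    have hp0 : (p : ℚ) ≠ 0 := by exact_mod_cast (Nat.prime_of_mem_primeFactors hp).ne_zero
    rw [← inv_div]
    congr 1
    field_simp
  rw [this, ← Finset.prod_pow]
  exact Finset.prod_congr rfl fun p _ => by rw [excess]; ring

/-- Expanding the Euler product gives a sum over sets of primes dividing `k`; the index set is made
independent of `k` so that the sums can be exchanged later. -/
theorem div_totient_pow_four_le {k L : ℕ} (hk : k ≠ 0) (hL : k ≤ L) :
    ((k : ℚ) / k.totient) ^ 4 ≤ ∑ t ∈ ((Finset.Icc 1 L).filter Nat.Prime).powerset,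
      if ∏ p ∈ t, p ∣ k then ∏ p ∈ t, excess p else 0 := by
  rw [div_totient_pow_four hk, Finset.prod_one_add, ← Finset.sum_filter]
  refine Finset.sum_le_sum_of_subset_of_nonneg ?_ ?_
  · intro t ht
    rw [Finset.mem_powerset] at ht
    have hp : ∀ p ∈ t, p.Prime := fun p h => Nat.prime_of_mem_primeFactors (ht h)
    have hd : ∀ p ∈ t, p ∣ k := fun p h => Nat.dvd_of_mem_primeFactors (ht h)
    refine Finset.mem_filter.2 ⟨Finset.mem_powerset.2 fun p h => Finset.mem_filter.2
      ⟨Finset.mem_Icc.2 ⟨(hp p h).one_le, ?_⟩, hp p h⟩, ?_⟩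
    · exact (Nat.le_of_dvd (Nat.pos_of_ne_zero hk) (hd p h)).trans hL
    · exact Finset.prod_primes_dvd k (fun p h => (hp p h).prime) hd
  · intro t ht _
    have := Finset.mem_powerset.1 (Finset.mem_filter.1 ht).1
    exact Finset.prod_nonneg fun p h => excess_nonneg (Finset.mem_filter.1 (this h)).2.two_le

/-- Write `φ(k)⁻⁴ = (k/φ(k))⁴ k⁻⁴`, expand the first factor over squarefree `d ∣ k`, and sum over
multiples of `d` first. The constant is `4/3 * 48`. -/
theorem sum_inv_totient_pow_four_le {y : ℕ} (hy : 1 ≤ y) (L : ℕ) :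
    ∑ k ∈ Finset.Ioc y L, ((k.totient : ℚ) ^ 4)⁻¹ ≤ 64 / (y : ℚ) ^ 3 := by
  set S := (Finset.Icc 1 L).filter Nat.Prime
  have hyq : (1 : ℚ) ≤ y := by exact_mod_cast hy
  calc _ ≤ ∑ k ∈ Finset.Ioc y L, ∑ t ∈ S.powerset,
          if ∏ p ∈ t, p ∣ k then (∏ p ∈ t, excess p) * ((k : ℚ) ^ 4)⁻¹ else 0 := by
        refine Finset.sum_le_sum fun k hk => ?_
        rw [Finset.mem_Ioc] at hk
        have hk0 : (k : ℚ) ≠ 0 := by exact_mod_cast (by omega : k ≠ 0)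
        have h := mul_le_mul_of_nonneg_right
          (div_totient_pow_four_le (by omega : k ≠ 0) hk.2)
          (by positivity : 0 ≤ ((k : ℚ) ^ 4)⁻¹)
        rw [Finset.sum_mul] at h
        simp only [ite_mul, zero_mul] at h
        refine le_trans (le_of_eq ?_) h
        rw [div_pow]
        field_simp
    _ = ∑ t ∈ S.powerset, (∏ p ∈ t, excess p) *
          ∑ k ∈ (Finset.Ioc y L).filter (∏ p ∈ t, p ∣ ·), ((k : ℚ) ^ 4)⁻¹ := by
        rw [Finset.sum_comm]
        refine Finset.sum_congr rfl fun t _ => ?_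
        rw [← Finset.sum_filter, Finset.mul_sum]
    _ ≤ ∑ t ∈ S.powerset, 4 / 3 / (y : ℚ) ^ 3 * ∏ p ∈ t, (excess p / p) := by
        refine Finset.sum_le_sum fun t ht => ?_
        have hp : ∀ p ∈ t, p.Prime := fun p h =>
          (Finset.mem_filter.1 (Finset.mem_powerset.1 ht h)).2
        refine (mul_le_mul_of_nonneg_left (sum_multiples_inv_pow_four_le
          (Finset.one_le_prod' fun p h => (hp p h).one_le) hy L)
          (Finset.prod_nonneg fun p h => excess_nonneg (hp p h).two_le)).trans (le_of_eq ?_)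
        rw [Finset.prod_div_distrib]
        push_cast
        rw [mul_comm (∏ p ∈ t, (p : ℚ)), ← div_div]
        ring
    _ = 4 / 3 / (y : ℚ) ^ 3 * ∏ p ∈ S, (1 + excess p / p) := by
        rw [← Finset.mul_sum, Finset.prod_one_add]
    _ ≤ 4 / 3 / (y : ℚ) ^ 3 * 48 :=
        mul_le_mul_of_nonneg_left (prod_primes_le L) (by positivity)
    _ = _ := by ring

/-- At most `5 * x` positive integers have totient at most `x`. -/
theorem card_totient_le (x L : ℕ) :
    ((Finset.Icc 1 L).filter (fun k => k.totient ≤ x)).card ≤ 5 * x := by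
  rcases Nat.eq_zero_or_pos x with rfl | hx
  · rw [mul_zero, Nat.le_zero, Finset.card_eq_zero, Finset.filter_eq_empty_iff]
    intro k hk
    have := Nat.totient_pos.2 (Finset.mem_Icc.1 hk).1
    omega
  -- With cutoff `4x` the tail contributes at most `x⁴ * 64 / (4x)³ = x`.
  have hsub : (Finset.Icc 1 L).filter (fun k => k.totient ≤ x) ⊆
      Finset.Icc 1 (4 * x) ∪ (Finset.Ioc (4 * x) L).filter (fun k => k.totient ≤ x) := by
    intro k hk
    simp only [Finset.mem_filter, Finset.mem_union, Finset.mem_Icc, Finset.mem_Ioc] at hk ⊢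
    omega
  have hxq : (1 : ℚ) ≤ x := by exact_mod_cast hx
  have htail : ((Finset.Ioc (4 * x) L).filter (fun k => k.totient ≤ x)).card ≤ x := by
    have h := sum_inv_totient_pow_four_le (by omega : 1 ≤ 4 * x) L
    have h1 : (((Finset.Ioc (4 * x) L).filter (fun k => k.totient ≤ x)).card : ℚ) *
        ((x : ℚ) ^ 4)⁻¹ ≤ ∑ k ∈ Finset.Ioc (4 * x) L, ((k.totient : ℚ) ^ 4)⁻¹ := by
      rw [← nsmul_eq_mul, ← Finset.sum_const]
      calc _ ≤ ∑ k ∈ (Finset.Ioc (4 * x) L).filter (fun k => k.totient ≤ x),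
            ((k.totient : ℚ) ^ 4)⁻¹ := by
              refine Finset.sum_le_sum fun k hk => ?_
              rw [Finset.mem_filter, Finset.mem_Ioc] at hk
              have h0 : 0 < k.totient := Nat.totient_pos.2 (by omega)
              have h1 : (k.totient : ℚ) ≤ x := by exact_mod_cast hk.2
              gcongr
        _ ≤ _ := Finset.sum_le_sum_of_subset_of_nonneg (Finset.filter_subset _ _)
              (fun _ _ _ => by positivity)
    have h2 := h1.trans h
    rw [← div_eq_mul_inv, div_le_iff₀ (by positivity)] at h2
    have h3 : 64 / ((4 * x : ℕ) : ℚ) ^ 3 * (x : ℚ) ^ 4 = x := by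
      push_cast
      field_simp
      norm_num
    rw [h3] at h2
    exact_mod_cast h2
  have := (Finset.card_le_card hsub).trans (Finset.card_union_le _ _)
  rw [Nat.card_Icc] at this
  omega

theorem finite_totient_le (x : ℕ) :
    ∃ s : Finset ℕ, (∀ k, 1 ≤ k → k.totient ≤ x → k ∈ s) ∧ s.card ≤ 5 * x := by
  have hf : {k : ℕ | 1 ≤ k ∧ k.totient ≤ x}.Finite := by
    by_contra hinf
    obtain ⟨t, ht, hc⟩ := Set.Infinite.exists_subset_card_eq hinf (5 * x + 1)
    have hle : t ⊆ (Finset.Icc 1 (t.sup id)).filter (fun k => k.totient ≤ x) := fun k hk =>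
      Finset.mem_filter.2 ⟨Finset.mem_Icc.2 ⟨(ht hk).1, Finset.le_sup (f := id) hk⟩, (ht hk).2⟩
    have := (Finset.card_le_card hle).trans (card_totient_le x _)
    omega
  refine ⟨hf.toFinset, fun k h1 h2 => hf.mem_toFinset.2 ⟨h1, h2⟩, ?_⟩
  refine (Finset.card_le_card fun k hk => ?_).trans (card_totient_le x (hf.toFinset.sup id))
  have h := hf.mem_toFinset.1 hk
  exact Finset.mem_filter.2 ⟨Finset.mem_Icc.2 ⟨h.1, Finset.le_sup (f := id) hk⟩, h.2⟩

/-! ### Roots of `v_n` and roots of unity -/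

open IntermediateField

section Roots

variable {K L : Type*} [Field K] [Field L] [Algebra K L] {D u v : K[X]}

theorem aeval_add_mul_pow {x s : L} (hs : s * s = aeval x D) (n : ℕ) :
    (aeval x u + aeval x v * s) ^ n =
      aeval x ((⟨u, v⟩ : QuadraticAlgebra K[X] D 0) ^ n).re + aeval x (pellV D u v n) * s := by
  unfold pellV
  induction n with
  | zero => simp [QuadraticAlgebra.re_one, QuadraticAlgebra.im_one]
  | succ n ih =>
    rw [pow_succ, ih, pow_succ, QuadraticAlgebra.re_mul, QuadraticAlgebra.im_mul]
    simp only [map_add, map_mul, zero_mul, add_zero, ← hs]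
    ring

theorem exists_root_of_unity [IsAlgClosed L] (h : u ^ 2 - D * v ^ 2 = 1) {x : L} {n : ℕ}
    (hx : aeval x (pellV D u v n) = 0) :
    ∃ ζ : L, ζ ^ (2 * n) = 1 ∧ ζ ^ 2 + 1 = 2 * aeval x u * ζ := by
  obtain ⟨s, hs⟩ := IsAlgClosed.exists_eq_mul_self (aeval x D)
  have h1 := aeval_add_mul_pow (u := u) (v := v) hs.symm n
  have h2 := aeval_add_mul_pow (u := u) (v := v) (s := -s) (by rw [hs]; ring) n
  have h3 : aeval x u ^ 2 - s * s * aeval x v ^ 2 = 1 := by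
    rw [← hs]
    simpa using congrArg (aeval x) h
  rw [hx, zero_mul, add_zero] at h1 h2
  refine ⟨aeval x u + aeval x v * s, ?_, ?_⟩
  · rw [two_mul, pow_add]
    nth_rewrite 2 [h1]
    rw [← h2, ← mul_pow]
    convert one_pow n using 2
    linear_combination h3
  · linear_combination -h3

end Roots

/-- At a point where `u = 2`, vanishing would give a root of unity with `|ζ + ζ⁻¹| = 4 > 2`. -/
theorem pellV_ne_zero {D u v : ℚ[X]} (h : u ^ 2 - D * v ^ 2 = 1) (hu : 0 < u.natDegree) {n : ℕ}
    (hn : 1 ≤ n) : pellV D u v n ≠ 0 := by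
  intro h0
  have hdeg : (u.map (algebraMap ℚ ℂ) - C 2).degree ≠ 0 := by
    rw [degree_sub_C] <;> rw [degree_map]
    · exact (natDegree_pos_iff_degree_pos.1 hu).ne'
    · exact natDegree_pos_iff_degree_pos.1 hu
  obtain ⟨x, hx⟩ := IsAlgClosed.exists_root _ hdeg
  have hx : aeval x u = 2 := by
    rw [IsRoot.def, eval_sub, eval_C, eval_map_algebraMap] at hx
    exact sub_eq_zero.1 hx
  obtain ⟨ζ, h1, h2⟩ := exists_root_of_unity (L := ℂ) h (x := x) (n := n) (by rw [h0, map_zero])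
  have hn1 : ‖ζ‖ = 1 := Complex.norm_eq_one_of_pow_eq_one h1 (by omega)
  have h3 : ‖ζ ^ 2 + 1‖ = 4 := by
    rw [h2, hx, norm_mul, hn1]
    norm_num
  have h4 : ‖ζ ^ 2 + 1‖ ≤ 2 := by
    refine (norm_add_le _ _).trans ?_
    rw [norm_pow, hn1]
    norm_num
  linarith

theorem cyclotomic_eq_minpoly_of_isPrimitiveRoot {L : Type*} [Field L] [Algebra ℚ L] {ζ : L} {k : ℕ}
    (hζ : IsPrimitiveRoot ζ k) (hk : 0 < k) : cyclotomic k ℚ = minpoly ℚ ζ := by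
  refine minpoly.eq_of_irreducible_of_monic (cyclotomic.irreducible_rat hk) ?_
    (cyclotomic.monic k ℚ)
  have : CharZero L := algebraRat.charZero L
  have : NeZero (k : L) := ⟨Nat.cast_ne_zero.2 hk.ne'⟩
  rw [aeval_def, eval₂_eq_eval_map, map_cyclotomic]
  exact hζ.isRoot_cyclotomic hk

theorem natDegree_minpoly_le_finrank_mul (F K : Type*) {L : Type*} [Field F] [Field K] [Field L]
    [Algebra F K] [Algebra F L] [Algebra K L] [IsScalarTower F K L] [FiniteDimensional F K]
    {z : L} (hz : IsIntegral K z) :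
    (minpoly F z).natDegree ≤ Module.finrank F K * (minpoly K z).natDegree := by
  have : FiniteDimensional K K⟮z⟯ := adjoin.finiteDimensional hz
  have : FiniteDimensional F K⟮z⟯ := FiniteDimensional.trans F K K⟮z⟯
  have : IsScalarTower F K⟮z⟯ L := .of_algebraMap_eq fun _ => rfl
  have h := minpoly.natDegree_le (A := F) (AdjoinSimple.gen K z)
  rwa [← minpoly.algebraMap_eq (algebraMap K⟮z⟯ L).injective, AdjoinSimple.algebraMap_gen,
    ← Module.finrank_mul_finrank F K K⟮z⟯, adjoin.finrank hz] at h

theorem natDegree_minpoly_le_of_quadratic {F L : Type*} [Field F] [Field L] [Algebra F L] {x z : L}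
    (hx : IsIntegral F x) {c : L} (hc : c ∈ F⟮x⟯) (h : z ^ 2 + 1 = 2 * c * z) :
    (minpoly F z).natDegree ≤ 2 * (minpoly F x).natDegree := by
  let q : F⟮x⟯[X] := X ^ 2 - C (2 * ⟨c, hc⟩) * X + C 1
  have hq : q.natDegree ≤ 2 := by
    unfold q
    compute_degree
  have hqm : q.Monic := by
    unfold q
    monicity!
  have hqz : aeval z q = 0 := by
    have : aeval z q = z ^ 2 - 2 * c * z + 1 := by
      simp only [q, map_add, map_sub, map_mul, map_pow, aeval_X, aeval_C, map_one]
      rfl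
    rw [this]
    linear_combination h
  have hint : IsIntegral F⟮x⟯ z := ⟨q, hqm, hqz⟩
  have hd : (minpoly F⟮x⟯ z).natDegree ≤ 2 :=
    (natDegree_le_of_dvd (minpoly.dvd _ _ hqz) hqm.ne_zero).trans hq
  have : FiniteDimensional F F⟮x⟯ := adjoin.finiteDimensional hx
  calc _ ≤ Module.finrank F F⟮x⟯ * (minpoly F⟮x⟯ z).natDegree :=
        natDegree_minpoly_le_finrank_mul F F⟮x⟯ hint
    _ ≤ _ := by
        rw [adjoin.finrank hx, mul_comm 2]
        exact Nat.mul_le_mul_left _ hd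

/-- Cyclotomic polynomials are irreducible over `ℚ`, so an automorphism carries `ξ` to any given
primitive `ζ`, and carries `x` to another root of `P`. -/
theorem exists_root_of_irreducible {L : Type*} [Field L] [Algebra ℚ L] [IsAlgClosure ℚ L]
    {D u v P : ℚ[X]} (h : u ^ 2 - D * v ^ 2 = 1) {n : ℕ} (hn : 1 ≤ n) (hP : P.Monic)
    (hirr : Irreducible P) (hdvd : P ∣ pellV D u v n) :
    ∃ k : ℕ, 1 ≤ k ∧ k.totient ≤ 2 * P.natDegree ∧ ∀ ζ : L, IsPrimitiveRoot ζ k →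
      ∃ x : L, minpoly ℚ x = P ∧ ζ ^ 2 + 1 = 2 * aeval x u * ζ := by
  have : IsAlgClosed L := IsAlgClosure.isAlgClosed ℚ
  have : Algebra.IsAlgebraic ℚ L := IsAlgClosure.isAlgebraic
  have : CharZero L := algebraRat.charZero L
  have : Normal ℚ L := IsAlgClosure.normal ℚ L
  obtain ⟨x, hx⟩ := IsAlgClosed.exists_aeval_eq_zero L P hirr.degree_pos.ne'
  have hmin : minpoly ℚ x = P := (minpoly.eq_of_irreducible_of_monic hirr hx hP).symm
  have hxn : aeval x (pellV D u v n) = 0 := by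
    obtain ⟨q, hq⟩ := hdvd
    rw [hq, map_mul, hx, zero_mul]
  obtain ⟨ξ, h1, h2⟩ := exists_root_of_unity h hxn
  have hk : 0 < orderOf ξ := orderOf_pos_iff.2 (isOfFinOrder_iff_pow_eq_one.2 ⟨_, by omega, h1⟩)
  have hξ := IsPrimitiveRoot.orderOf ξ
  refine ⟨orderOf ξ, hk, ?_, fun ζ hζ => ?_⟩
  · rw [← hmin, ← natDegree_cyclotomic (orderOf ξ) ℚ,
      cyclotomic_eq_minpoly_of_isPrimitiveRoot hξ hk]
    refine natDegree_minpoly_le_of_quadratic (Algebra.IsIntegral.isIntegral x) ?_ h2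
    exact algebra_adjoin_le_adjoin ℚ {x} (aeval_mem_adjoin_singleton ℚ x)
  · have hconj : IsConjRoot ℚ ζ ξ := by
      rw [isConjRoot_def, ← cyclotomic_eq_minpoly_of_isPrimitiveRoot hζ hk,
        ← cyclotomic_eq_minpoly_of_isPrimitiveRoot hξ hk]
    obtain ⟨σ, hσ⟩ := isConjRoot_iff_exists_algEquiv.1 hconj
    refine ⟨σ x, ?_, ?_⟩
    · rw [minpoly.algEquiv_eq, hmin]
    · have := congrArg σ h2
      simpa only [map_add, map_pow, map_mul, map_one, map_ofNat, hσ,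
        ← aeval_algHom_apply] using this

theorem natDegree_pos_of_pell {D u v : ℚ[X]} (h : u ^ 2 - D * v ^ 2 = 1) (hv : v ≠ 0)
    (hD : 0 < D.natDegree) : 0 < u.natDegree := by
  by_contra hu
  have hD0 : D ≠ 0 := by
    rintro rfl
    simp at hD
  have h1 : D * v ^ 2 = u ^ 2 - 1 := by linear_combination -h
  have h2 : (u ^ 2 - 1 : ℚ[X]).natDegree ≤ 0 := by
    refine (natDegree_sub_le _ _).trans ?_
    rw [natDegree_pow, natDegree_one]
    omega
  rw [← h1, natDegree_mul hD0 (pow_ne_zero 2 hv)] at h2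
  omega

/-! ### Counting the irreducible factors -/

theorem card_roots_le {L : Type*} [Field L] [Algebra ℚ L] {u : ℚ[X]}
    (hu : 0 < u.natDegree) {ζ : L} (hζ : ζ ≠ 0) :
    ∃ s : Finset L, s.card ≤ u.natDegree ∧ ∀ x, ζ ^ 2 + 1 = 2 * aeval x u * ζ → x ∈ s := by
  have : CharZero L := algebraRat.charZero L
  classical
  set c : L := (ζ ^ 2 + 1) / (2 * ζ)
  refine ⟨(u.map (algebraMap ℚ L) - C c).roots.toFinset, ?_, fun x hx => ?_⟩
  · refine (Multiset.toFinset_card_le _).trans ((card_roots' _).trans ?_)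
    rw [natDegree_sub_C, natDegree_map]
  · have h0 : u.map (algebraMap ℚ L) - C c ≠ 0 := by
      intro h
      have := congrArg natDegree h
      rw [natDegree_sub_C, natDegree_map, natDegree_zero] at this
      omega
    rw [Multiset.mem_toFinset, mem_roots h0, IsRoot.def, eval_sub, eval_C, eval_map_algebraMap,
      sub_eq_zero, eq_div_iff (by simpa using hζ), hx]
    ring

theorem newFactors_finite_and_ncard_le (L : Type*) [Field L] [Algebra ℚ L] [IsAlgClosure ℚ L]
    {D u v : ℚ[X]} (h : u ^ 2 - D * v ^ 2 = 1) (hv : v ≠ 0) (hD : 0 < D.natDegree) (N : ℕ) :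
    (newFactors D u v N).Finite ∧ (newFactors D u v N).ncard ≤ 10 * N * u.natDegree := by
  classical
  have : IsAlgClosed L := IsAlgClosure.isAlgClosed ℚ
  have : CharZero L := algebraRat.charZero L
  have hu := natDegree_pos_of_pell h hv hD
  obtain ⟨s, hs, hcard⟩ := finite_totient_le (2 * N)
  -- `R` depends on `k` alone: the same `ζ` serves every `P` and `n`.
  have hR : ∀ k : ℕ, ∃ R : Finset L, R.card ≤ u.natDegree ∧ ∀ n P, 1 ≤ n → P.Monic →
      Irreducible P → P ∣ pellV D u v n → (1 ≤ k ∧ k.totient ≤ 2 * P.natDegree ∧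
        ∀ ζ : L, IsPrimitiveRoot ζ k →
          ∃ x : L, minpoly ℚ x = P ∧ ζ ^ 2 + 1 = 2 * aeval x u * ζ) → P ∈ R.image (minpoly ℚ) := by
    intro k
    rcases Nat.eq_zero_or_pos k with rfl | hk
    · exact ⟨∅, by simp, fun _ _ _ _ _ _ hk => absurd hk.1 (by omega)⟩
    have : NeZero (k : L) := ⟨Nat.cast_ne_zero.2 hk.ne'⟩
    obtain ⟨ζ, hζ⟩ := HasEnoughRootsOfUnity.exists_primitiveRoot L k
    obtain ⟨R, hR, hmem⟩ := card_roots_le (L := L) hu (hζ.ne_zero hk.ne')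
    refine ⟨R, hR, fun n P _ _ _ _ hP => ?_⟩
    obtain ⟨x, hx, hx'⟩ := hP.2.2 ζ hζ
    exact Finset.mem_image.2 ⟨x, hmem x hx', hx⟩
  choose R hRcard hR using hR
  have hsub : newFactors D u v N ⊆ ((s.biUnion R).image (minpoly ℚ) : Finset ℚ[X]) := by
    rintro P ⟨hP, hirr, hdeg, n, hn, hdvd⟩
    replace hdvd : P ∣ pellV D u v n :=
      hdvd.trans (Dvd.intro_left _ (pellVOld_mul_pellVNew D u v n))
    obtain ⟨k, hk⟩ := exists_root_of_irreducible (L := L) h hn hP hirr hdvd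
    obtain ⟨x, hx, rfl⟩ := Finset.mem_image.1 (hR k n P hn hP hirr hdvd hk)
    refine Finset.mem_coe.2 (Finset.mem_image_of_mem _ (Finset.mem_biUnion.2 ⟨k, ?_, hx⟩))
    exact hs k hk.1 (hk.2.1.trans (by omega))
  refine ⟨(Finset.finite_toSet _).subset hsub, ?_⟩
  calc _ ≤ ((s.biUnion R).image (minpoly ℚ)).card := by
        rw [← Set.ncard_coe_finset]
        exact Set.ncard_le_ncard hsub (Finset.finite_toSet _)
    _ ≤ (s.biUnion R).card := Finset.card_image_le
    _ ≤ s.card * u.natDegree := Finset.card_biUnion_le_card_mul _ _ _ fun k _ => hRcard k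
    _ ≤ 5 * (2 * N) * u.natDegree := Nat.mul_le_mul_right _ hcard
    _ = _ := by ring

end PellNewFactors

theorem mainTheorem2 :
    ∃ N₀ : ℕ, ∀ D u v : ℚ[X], 0 < D.natDegree → IsFundamentalSolution D u v →
      ∀ N : ℕ, N₀ ≤ N →
        (newFactors D u v N).Finite ∧ (newFactors D u v N).ncard ≤ 10 * N * u.natDegree :=
  -- The totient bound is not asymptotic, so the threshold can be 0.
  ⟨0, fun _ _ _ hD h N _ => @PellNewFactors.newFactors_finite_and_ncard_le (AlgebraicClosure ℚ) _
    (AlgebraicClosure.instAlgebra ℚ) inferInstance _ _ _ h.pell h.ne_zero hD N⟩
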